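/- Let $\alpha,\beta>0$ with $\rho=\alpha/\beta<1$ and let $L\ge 1$ be an integer. For $k\ge 0$ put $\tilde u(k)=\rho^{1+L+\cdots+L^{k-1}}$ (so $\tilde u(0)=1$), and for $k\ge1$ let $\pi(k)=L^{k-1}\rho^{L+L^2+\cdots+L^{k-1}}$ (so $\pi(1)=1$) be the potential coefficients. Let $L_2(\pi)$ be the real Hilbert space of sequences $x=(x(k))_{k\ge0}$ with $x(0)=0$ and $\|x\|_{L_2(\pi)}^2=\sum_{k\ge1}x(k)^2\pi(k)^{-1}<\infty$, with scalar product $(x,y)_{L_2(\pi)}=\sum_{k\ge1}x(k)y(k)\pi(k)^{-1}$. Let $\mathcal K=\mathbf K(\tilde u)$ be given by $\mathcal Kx(0)=0$ and $$\mathcal Kx(k)=\alpha L\,\tilde u(k-1)^{L-1}x(k-1)-\bigl(\alpha L\,\tilde u(k)^{L-1}+\beta\bigr)x(k)+\beta x(k+1),\qquad k\ge1.$$ Then $\mathcal K$ is a bounded self-adjoint operator on $L_2(\pi)$. The spectrum of $-\mathcal K$ in $L_2(\pi)$ has a least point $\gamma$, and $0<\gamma\le\beta$. For every $z_0\in L_2(\pi)$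 the equation $\dot z_t=\mathcal Kz_t$, $t\ge0$, has in $L_2(\pi)$ the unique solution $z_t=\mathrm e^{\mathcal Kt}z_0$ starting at $z_0$, and $$\|z_t\|_{L_2(\pi)}\le \mathrm e^{-\gamma t}\|z_0\|_{L_2(\pi)},\qquad t\ge0.$$ -/

import Mathlib

namespace MeanFieldQueue

/-- A sequence of strictly positive weights `w(k)`, `k ≥ 1` (the value at `0` is irrelevant). -/
structure Weight where
  toFun : ℕ → ℝ
  pos : ∀ k, 1 ≤ k → 0 < toFun k

instance : CoeFun Weight (fun _ => ℕ → ℝ) := ⟨Weight.toFun⟩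

/-- Membership in `L₂(w)`: real sequences `(x(k))_{k ≥ 0}` with `x(0) = 0` and
`∑_{k ≥ 1} x(k)² w(k)⁻¹ < ∞`. -/
def MemL2 (w : Weight) (x : ℕ → ℝ) : Prop :=
  x 0 = 0 ∧ Summable fun k : ℕ => x (k + 1) ^ 2 / w (k + 1)

theorem Weight.pos_succ (w : Weight) (k : ℕ) : 0 < w (k + 1) := w.pos (k + 1) (Nat.le_add_left 1 k)

theorem MemL2.summable_mul {w : Weight} {x y : ℕ → ℝ} (hx : MemL2 w x) (hy : MemL2 w y) :
    Summable fun k : ℕ => x (k + 1) * y (k + 1) / w (k + 1) := by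
  refine Summable.of_norm_bounded (hx.2.add hy.2) fun k => ?_
  have hw := w.pos_succ k
  rw [Real.norm_eq_abs, abs_div, abs_of_pos hw, ← add_div]
  gcongr
  rw [abs_le]
  constructor <;> nlinarith [sq_nonneg (x (k + 1) + y (k + 1)), sq_nonneg (x (k + 1) - y (k + 1)),
    sq_nonneg (x (k + 1)), sq_nonneg (y (k + 1))]

/-- `L₂(w)` as a linear subspace of the space of real sequences. -/
def l2Submodule (w : Weight) : Submodule ℝ (ℕ → ℝ) where
  carrier := {x | MemL2 w x}
  zero_mem' := ⟨rfl, by simp [summable_zero]⟩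
  add_mem' := by
    intro x y hx hy
    refine ⟨by simp [hx.1, hy.1], ?_⟩
    refine ((hx.2.add hy.2).add ((hx.summable_mul hy).mul_left 2)).congr fun k => ?_
    simp only [Pi.add_apply]
    ring
  smul_mem' := by
    intro c x hx
    refine ⟨by simp [hx.1], ?_⟩
    refine (hx.2.mul_left (c ^ 2)).congr fun k => ?_
    simp only [Pi.smul_apply, smul_eq_mul]
    ring

/-- The scalar product `(x, y)_{L₂(w)} = ∑_{k ≥ 1} x(k) y(k) w(k)⁻¹`. -/
@[reducible]
noncomputable def l2Core (w : Weight) : InnerProductSpace.Core ℝ (l2Submodule w) where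
  inner x y := ∑' k : ℕ, x.1 (k + 1) * y.1 (k + 1) / w (k + 1)
  conj_inner_symm x y := by
    simp only [conj_trivial]
    exact tsum_congr fun k => by ring
  re_inner_nonneg x := by
    simp only [RCLike.re_to_real]
    exact tsum_nonneg fun k => div_nonneg (mul_self_nonneg _) (w.pos_succ k).le
  add_left x y z := by
    rw [← (MemL2.summable_mul x.2 z.2).tsum_add (MemL2.summable_mul y.2 z.2)]
    exact tsum_congr fun k => by
      rw [Submodule.coe_add, Pi.add_apply]; ring
  smul_left x y c := by
    simp only [conj_trivial]
    rw [← tsum_mul_left]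
    exact tsum_congr fun k => by
      rw [Submodule.coe_smul, Pi.smul_apply, smul_eq_mul]; ring
  definite x h := by
    have hnn : ∀ k : ℕ, 0 ≤ x.1 (k + 1) * x.1 (k + 1) / w (k + 1) := fun k =>
      div_nonneg (mul_self_nonneg _) (w.pos_succ k).le
    have h0 := (hasSum_zero_iff_of_nonneg hnn).1 (h ▸ (MemL2.summable_mul x.2 x.2).hasSum)
    apply Subtype.ext
    funext k
    cases k with
    | zero => exact x.2.1
    | succ k =>
      have hk := congrFun h0 k
      simp only [Pi.zero_apply, div_eq_zero_iff, mul_self_eq_zero] at hk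
      exact hk.resolve_right (w.pos_succ k).ne'

/-- The space `L₂(w)`; its topology is the one of the weighted norm below, not the product one. -/
def L2 (w : Weight) : Type := l2Submodule w

namespace L2

variable {w : Weight}

noncomputable instance : NormedAddCommGroup (L2 w) :=
  @InnerProductSpace.Core.toNormedAddCommGroup ℝ (l2Submodule w) _ _ _ (l2Core w)

noncomputable instance : InnerProductSpace ℝ (L2 w) :=
  @InnerProductSpace.ofCore ℝ (l2Submodule w) _ _ _ (l2Core w).toCore

/-- The sequence underlying an element of `L₂(w)`. -/
def seq (x : L2 w) : ℕ → ℝ := Subtype.val (p := fun x => x ∈ l2Submodule w) x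

/-- The element of `L₂(w)` given by a sequence in it. -/
def mk (x : ℕ → ℝ) (hx : MemL2 w x) : L2 w :=
  Subtype.mk (p := fun x => x ∈ l2Submodule w) x hx

instance : CoeFun (L2 w) (fun _ => ℕ → ℝ) := ⟨seq⟩

theorem mem (x : L2 w) : MemL2 w x := Subtype.property (p := fun x => x ∈ l2Submodule w) x

theorem ext_seq {x y : L2 w} (h : ∀ k, x (k + 1) = y (k + 1)) : x = y := by
  apply Subtype.ext
  funext k
  cases k with
  | zero => exact x.mem.1.trans y.mem.1.symm
  | succ k => exact h k

theorem mk_apply (x : ℕ → ℝ) (hx : MemL2 w x) (k : ℕ) : mk x hx k = x k := rfl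

theorem add_apply (x y : L2 w) (k : ℕ) : (x + y) k = x k + y k := rfl

theorem smul_apply (c : ℝ) (x : L2 w) (k : ℕ) : (c • x) k = c * x k := rfl

theorem inner_def (x y : L2 w) :
    inner ℝ x y = ∑' k : ℕ, x (k + 1) * y (k + 1) / w (k + 1) := rfl

/-- `‖x‖²_{L₂(w)} = ∑_{k ≥ 1} x(k)² w(k)⁻¹`. -/
theorem norm_sq (x : L2 w) : ‖x‖ ^ 2 = ∑' k : ℕ, x (k + 1) ^ 2 / w (k + 1) := by
  rw [← real_inner_self_eq_norm_sq, inner_def]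
  exact tsum_congr fun k => by rw [sq]

theorem div_sqrt_sq (w : Weight) (a : ℝ) (k : ℕ) :
    (a / √(w (k + 1))) ^ 2 = a ^ 2 / w (k + 1) := by
  rw [div_pow, Real.sq_sqrt (w.pos_succ k).le]

/-- The isometry `x ↦ (x(k+1) w(k+1)^{-1/2})_{k ≥ 0}` of `L₂(w)` onto `ℓ₂`. -/
noncomputable def toLp (w : Weight) : L2 w ≃ₗᵢ[ℝ] lp (fun _ : ℕ => ℝ) 2 where
  toFun x := ⟨fun k => x (k + 1) / √(w (k + 1)), by
    refine memℓp_gen ?_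
    refine x.mem.2.congr fun k => ?_
    rw [← div_sqrt_sq]
    simp only [ENNReal.toReal_ofNat, Real.norm_eq_abs, Real.rpow_ofNat, sq_abs]⟩
  invFun y := mk (fun k => y (k - 1) * √(w k) * (if k = 0 then 0 else 1)) (by
    refine ⟨by simp, ?_⟩
    have hy := (lp.memℓp y).summable (by simp)
    refine hy.congr fun k => ?_
    have hw := w.pos_succ k
    simp [mul_pow, Real.sq_sqrt hw.le, hw.ne'])
  left_inv x := ext_seq fun k => by
    have hw := Real.sqrt_pos.2 (w.pos_succ k)
    simp [mk_apply, hw.ne']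
  right_inv y := by
    ext k
    have hw := Real.sqrt_pos.2 (w.pos_succ k)
    simp [mk_apply, hw.ne']
  map_add' x y := by
    ext k
    exact add_div _ _ _
  map_smul' c x := by
    ext k
    simp [smul_apply, mul_div_assoc]
  norm_map' x := by
    have h : ∀ a b : ℝ, 0 ≤ a → 0 ≤ b → a ^ 2 = b ^ 2 → a = b := fun a b ha hb hab =>
      (pow_left_inj₀ ha hb two_ne_zero).1 hab
    refine h _ _ (norm_nonneg _) (norm_nonneg _) ?_
    have := lp.norm_rpow_eq_tsum (p := 2) (by simp) (E := fun _ : ℕ => ℝ)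
      (⟨fun k => x (k + 1) / √(w (k + 1)), by
        refine memℓp_gen ?_
        refine x.mem.2.congr fun k => ?_
        rw [← div_sqrt_sq]
        simp only [ENNReal.toReal_ofNat, Real.norm_eq_abs, Real.rpow_ofNat, sq_abs]⟩)
    rw [norm_sq]
    change ‖(⟨fun k => x (k + 1) / √(w (k + 1)), _⟩ : lp (fun _ : ℕ => ℝ) 2)‖ ^ 2 = _
    simpa only [ENNReal.toReal_ofNat, Real.norm_eq_abs, Real.rpow_ofNat, sq_abs, div_sqrt_sq] using this

instance : CompleteSpace (L2 w) :=
  (completeSpace_congr (e := (toLp w).toEquiv) (toLp w).isometry.isUniformEmbedding).2 inferInstance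

end L2

/-- The operator `K(v)` on sequences:
`K(v)x(k) = αL v(k-1)^{L-1} x(k-1) - (αL v(k)^{L-1} + β) x(k) + β x(k+1)` for `k ≥ 1`, and
`K(v)x(0) = 0`. -/
noncomputable def opK (α β : ℝ) (L : ℕ) (v x : ℕ → ℝ) : ℕ → ℝ
  | 0 => 0
  | k + 1 => α * L * v k ^ (L - 1) * x k - (α * L * v (k + 1) ^ (L - 1) + β) * x (k + 1)
      + β * x (k + 2)

/-- The equilibrium `ũ(k) = ρ^{1 + L + ⋯ + L^{k-1}}`. -/
noncomputable def uTilde (ρ : ℝ) (L : ℕ) (k : ℕ) : ℝ := ρ ^ ∑ i ∈ Finset.range k, L ^ i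

/-- The potential coefficients `π(k) = L^{k-1} ρ^{L + L² + ⋯ + L^{k-1}}`, `k ≥ 1`; the exponent
is `(L^k - L)/(L - 1)` for `L ≥ 2` and `k - 1` for `L = 1`. -/
noncomputable def potential (ρ : ℝ) (L : ℕ) (hρ : 0 < ρ) (hL : 1 ≤ L) : Weight where
  toFun k := (L : ℝ) ^ (k - 1) * ρ ^ ∑ i ∈ Finset.Ico 1 k, L ^ i
  pos k _ := by
    have : (0 : ℝ) < L := by exact_mod_cast hL
    positivity

end MeanFieldQueue

/-
With `T` the left shift `(Tx)(k) = x(k+1)` on `L₂(π)`, detailed balance turns `𝒦` into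
`-B B*` for `B = √β (1 - T)`, which gives self-adjointness. Some power of `T` is a strict
contraction because `π(n) → 0`, so `B` is invertible and `-𝒦` has its spectrum in `(0, ∞)`. As `B`
has the eigenvector `e₁` with eigenvalue `√β`, testing `B B*` on `x = (B*)⁻¹ e₁` bounds the least
point of the spectrum by `β`.
For the decay, put `c = ‖𝒦‖`: the operator `c + 𝒦` is positive and its norm `c - γ` is the greatest
point of its spectrum, whence `‖exp (t𝒦)‖ ≤ exp (-ct) exp (t ‖c + 𝒦‖) = exp (-γt)`.
-/

namespace MeanFieldQueue

section NormedRing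

theorem isUnit_one_sub_of_norm_pow_lt_one {R : Type*} [NormedRing R] [CompleteSpace R] {a : R}
    {n : ℕ} (h : ‖a ^ n‖ < 1) : IsUnit (1 - a) := by
  have hunit := isUnit_one_sub_of_norm_lt_one h
  have hcomm : Commute (1 - a) (∑ i ∈ Finset.range n, a ^ i) :=
    Commute.sum_right _ _ _ fun i _ =>
      (Commute.one_left _).sub_left ((Commute.refl a).pow_right i)
  rw [← mul_neg_geom_sum] at hunit
  exact (hcomm.isUnit_mul_iff.1 hunit).1

variable {𝔸 : Type*} [NormedRing 𝔸] [NormOneClass 𝔸] [NormedAlgebra ℝ 𝔸] [CompleteSpace 𝔸]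

theorem norm_exp_le (a : 𝔸) : ‖NormedSpace.exp a‖ ≤ Real.exp ‖a‖ := by
  rw [Real.exp_eq_exp_ℝ]
  refine (NormedSpace.exp_series_hasSum_exp' (𝕂 := ℝ) a).norm_le_of_bounded
    (NormedSpace.exp_series_hasSum_exp' (𝕂 := ℝ) ‖a‖) fun n => ?_
  rw [norm_smul, Real.norm_of_nonneg (by positivity), smul_eq_mul]
  gcongr
  exact norm_pow_le a n

theorem norm_exp_smul_le_of_norm_smul_one_add_le {a : 𝔸} {c γ t : ℝ}
    (h : ‖c • (1 : 𝔸) + a‖ ≤ c - γ) (ht : 0 ≤ t) :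
    ‖NormedSpace.exp (t • a)‖ ≤ Real.exp (-γ * t) := by
  let +nondep : NormedAlgebra ℚ 𝔸 := .restrictScalars ℚ ℝ 𝔸
  have hsplit : t • a = algebraMap ℝ 𝔸 (-(c * t)) + t • (c • (1 : 𝔸) + a) := by
    rw [Algebra.algebraMap_eq_smul_one]
    module
  calc ‖NormedSpace.exp (t • a)‖
      = ‖algebraMap ℝ 𝔸 (Real.exp (-(c * t))) * NormedSpace.exp (t • (c • (1 : 𝔸) + a))‖ := by
        rw [hsplit, NormedSpace.exp_add_of_commute (Algebra.commutes _ _),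
          ← NormedSpace.algebraMap_exp_comm, Real.exp_eq_exp_ℝ]
    _ ≤ Real.exp (-(c * t)) * Real.exp ‖t • (c • (1 : 𝔸) + a)‖ := by
        grw [norm_mul_le, norm_exp_le (t • _)]
        rw [norm_algebraMap', Real.norm_of_nonneg (Real.exp_pos _).le]
    _ ≤ Real.exp (-(c * t)) * Real.exp (t * (c - γ)) := by
        rw [norm_smul, Real.norm_of_nonneg ht]
        gcongr
    _ = Real.exp (-γ * t) := by
        rw [← Real.exp_add]
        ring_nf

end NormedRing

section LinearODE

variable {E : Type*} [NormedAddCommGroup E]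

theorem hasDerivAt_exp_smul_apply {𝕜 : Type*} [RCLike 𝕜] [NormedSpace 𝕜 E] [CompleteSpace E]
    (K : E →L[𝕜] E) (z₀ : E) (t : 𝕜) :
    HasDerivAt (fun s : 𝕜 => NormedSpace.exp (s • K) z₀) (K (NormedSpace.exp (t • K) z₀)) t := by
  simpa using (hasDerivAt_exp_smul_const' (𝕂 := 𝕜) K t).clm_apply (hasDerivAt_const t z₀)

theorem eq_exp_smul_apply_of_hasDerivWithinAt [NormedSpace ℝ E] [CompleteSpace E] (K : E →L[ℝ] E)
    {z : ℝ → E} (hz : ∀ t, 0 ≤ t → HasDerivWithinAt z (K (z t)) (Set.Ici 0) t) {t : ℝ}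
    (ht : 0 ≤ t) : z t = NormedSpace.exp (t • K) (z 0) := by
  have hexp := hasDerivAt_exp_smul_apply K (z 0)
  exact ODE_solution_unique (v := fun _ x => K x) (fun _ => K.lipschitz)
    (fun s hs => (hz s hs.1).continuousWithinAt.mono Set.Icc_subset_Ici_self)
    (fun s hs => (hz s hs.1).mono (Set.Ici_subset_Ici.2 hs.1))
    (fun s _ => (hexp s).continuousAt.continuousWithinAt)
    (fun s _ => (hexp s).hasDerivWithinAt) (by simp) (Set.right_mem_Icc.2 ht)

end LinearODE

section LeastSpectralPoint

variable {E : Type*} [NormedAddCommGroup E] [InnerProductSpace ℝ E]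

theorem norm_mem_spectrum_of_isPositive [Nontrivial E] {P : E →L[ℝ] E} (hP : P.IsPositive) :
    ‖P‖ ∈ spectrum ℝ P := by
  by_contra hres
  obtain ⟨ε, hε, hle⟩ :=
    P.rayleighQuotient_le_of_norm_mem_resolventSet (spectrum.notMem_iff.1 hres)
  have habs : ∀ x, |P.rayleighQuotient x| = P.rayleighQuotient x := fun x =>
    abs_of_nonneg (div_nonneg (hP.re_inner_nonneg_left x) (sq_nonneg _))
  have hnorm : ‖P‖ ≤ ‖P‖ - ε := by
    conv_lhs => rw [P.norm_eq_iSup_rayleighQuotient hP.isSymmetric]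
    exact ciSup_le fun x => (habs x).trans_le (hle x)
  linarith

variable [CompleteSpace E]

theorem isPositive_norm_smul_one_sub {A : E →L[ℝ] E} (hA : IsSelfAdjoint A) :
    (‖A‖ • (1 : E →L[ℝ] E) - A).IsPositive := by
  refine ContinuousLinearMap.isPositive_def.2
    ⟨((IsSelfAdjoint.smul (.all ‖A‖) (.one _)).sub hA).isSymmetric, fun x => ?_⟩
  have hinner : inner ℝ (A x) x ≤ ‖A‖ * ‖x‖ ^ 2 := by
    grw [real_inner_le_norm, A.le_opNorm, sq, mul_assoc]
  simpa [ContinuousLinearMap.reApplyInnerSelf_apply, inner_sub_left, real_inner_smul_left]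
    using hinner

theorem isLeast_spectrum_of_isSelfAdjoint [Nontrivial E] {A : E →L[ℝ] E} (hA : IsSelfAdjoint A) :
    IsLeast (spectrum ℝ A) (‖A‖ - ‖‖A‖ • (1 : E →L[ℝ] E) - A‖) := by
  have hspec : ∀ r, r ∈ spectrum ℝ (‖A‖ • (1 : E →L[ℝ] E) - A) ↔ ‖A‖ - r ∈ spectrum ℝ A := by
    intro r
    rw [← Algebra.algebraMap_eq_smul_one, ← spectrum.singleton_sub_eq, Set.singleton_sub]
    exact ⟨fun ⟨x, hx, hxr⟩ => by rwa [← hxr, sub_sub_cancel],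
      fun h => ⟨_, h, sub_sub_cancel _ _⟩⟩
  refine ⟨(hspec _).1 (norm_mem_spectrum_of_isPositive (isPositive_norm_smul_one_sub hA)),
    fun r hr => ?_⟩
  have hr' : ‖A‖ - r ∈ spectrum ℝ (‖A‖ • (1 : E →L[ℝ] E) - A) := by
    rwa [hspec, sub_sub_cancel]
  linarith [(le_abs_self _).trans (spectrum.norm_le_norm_of_mem hr')]

section

variable {A : E →L[ℝ] E} {γ : ℝ} (hA : IsSelfAdjoint A) (hγ : IsLeast (spectrum ℝ A) γ)
include hA hγ

theorem norm_norm_smul_one_sub_of_isLeast_spectrum [Nontrivial E] :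
    ‖‖A‖ • (1 : E →L[ℝ] E) - A‖ = ‖A‖ - γ := by
  rw [hγ.unique (isLeast_spectrum_of_isSelfAdjoint hA), sub_sub_cancel]

theorem mul_norm_sq_le_inner_of_isLeast_spectrum (x : E) :
    γ * ‖x‖ ^ 2 ≤ inner ℝ (A x) x := by
  rcases subsingleton_or_nontrivial E with _ | _
  · simp [Subsingleton.elim x 0]
  have h : inner ℝ ((‖A‖ • (1 : E →L[ℝ] E) - A) x) x ≤ (‖A‖ - γ) * ‖x‖ ^ 2 := by
    grw [real_inner_le_norm, ContinuousLinearMap.le_opNorm,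
      norm_norm_smul_one_sub_of_isLeast_spectrum hA hγ, sq, mul_assoc]
  simp only [sub_apply, smul_apply, one_apply_eq_self, inner_sub_left, real_inner_smul_left,
    real_inner_self_eq_norm_sq] at h
  linarith

theorem norm_exp_smul_neg_apply_le (z₀ : E) {t : ℝ} (ht : 0 ≤ t) :
    ‖NormedSpace.exp (t • -A) z₀‖ ≤ Real.exp (-γ * t) * ‖z₀‖ := by
  nontriviality E
  have hnorm := norm_norm_smul_one_sub_of_isLeast_spectrum hA hγ
  rw [sub_eq_add_neg] at hnorm
  exact ContinuousLinearMap.le_of_opNorm_le _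
    (norm_exp_smul_le_of_norm_smul_one_add_le hnorm.le ht) z₀

end

section

variable {B : E →L[ℝ] E} {e : E} {μ γ : ℝ} (hB : IsUnit B)
include hB

theorem pos_of_mem_spectrum_mul_star (hγ : γ ∈ spectrum ℝ (B * star B)) : 0 < γ := by
  have hnonneg : 0 ≤ B * star B :=
    (ContinuousLinearMap.nonneg_iff_isPositive _).2 B.isPositive_self_comp_adjoint
  refine (spectrum_nonneg_of_nonneg hnonneg hγ).lt_of_ne ?_
  rintro rfl
  exact (spectrum.zero_notMem_iff ℝ).2 (hB.mul hB.star) hγ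

theorem le_sq_of_isLeast_spectrum_mul_star (he : e ≠ 0) (hBe : B e = μ • e)
    (hγ : IsLeast (spectrum ℝ (B * star B)) γ) : γ ≤ μ ^ 2 := by
  obtain ⟨x, hx⟩ := (ContinuousLinearMap.isUnit_iff_bijective.1 hB.star).2 e
  have hx0 : x ≠ 0 := by
    rintro rfl
    exact he (by rw [← hx, map_zero])
  have hinner : ‖e‖ ^ 2 = μ * inner ℝ x e := by
    rw [← real_inner_smul_right, ← hBe, ← ContinuousLinearMap.adjoint_inner_left,
      ← ContinuousLinearMap.star_eq_adjoint, hx, real_inner_self_eq_norm_sq]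
  have hnorm : ‖e‖ ≤ |μ| * ‖x‖ := by
    refine le_of_mul_le_mul_right ?_ (norm_pos_iff.2 he)
    calc ‖e‖ * ‖e‖ = μ * inner ℝ x e := by rw [← sq, hinner]
      _ ≤ |μ| * |inner ℝ x e| := by rw [← abs_mul]; exact le_abs_self _
      _ ≤ |μ| * ‖x‖ * ‖e‖ := by grw [abs_real_inner_le_norm, mul_assoc]
  refine le_of_mul_le_mul_right ?_ (pow_pos (norm_pos_iff.2 hx0) 2)
  calc γ * ‖x‖ ^ 2 ≤ inner ℝ ((B * star B) x) x :=
        mul_norm_sq_le_inner_of_isLeast_spectrum (.mul_star_self B) hγ x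
    _ = ‖e‖ ^ 2 := by
        rw [mul_apply_eq_comp, ← ContinuousLinearMap.adjoint_inner_right,
          ← ContinuousLinearMap.star_eq_adjoint, hx, real_inner_self_eq_norm_sq]
    _ ≤ (|μ| * ‖x‖) ^ 2 := by gcongr
    _ = μ ^ 2 * ‖x‖ ^ 2 := by rw [mul_pow, sq_abs]

theorem exists_isLeast_spectrum_mul_star (he : e ≠ 0) (hBe : B e = μ • e) :
    ∃ γ, IsLeast (spectrum ℝ (B * star B)) γ ∧ 0 < γ ∧ γ ≤ μ ^ 2 := by
  have : Nontrivial E := ⟨e, 0, he⟩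
  have hleast := isLeast_spectrum_of_isSelfAdjoint (IsSelfAdjoint.mul_star_self B)
  exact ⟨_, hleast, pos_of_mem_spectrum_mul_star hB hleast.1,
    le_sq_of_isLeast_spectrum_mul_star hB he hBe hleast⟩

end

end LeastSpectralPoint

/-- The bound `w(k + n) / w(k) ≤ C` for all `k ≥ 1`, under which the left shift by `n` places is
bounded on `L₂(w)` with norm at most `√C`. -/
def Weight.RatioLE (w : Weight) (n : ℕ) (C : ℝ) : Prop :=
  ∀ k, w (k + n + 1) ≤ C * w (k + 1)

namespace Weight.RatioLE

variable {w : Weight} {n : ℕ} {C : ℝ}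

theorem nonneg (h : w.RatioLE n C) : 0 ≤ C :=
  (pos_of_mul_pos_left ((w.pos_succ _).trans_le (h 0)) (w.pos_succ 0).le).le

theorem sq_div_le (h : w.RatioLE n C) (a : ℝ) (k : ℕ) :
    a ^ 2 / w (k + 1) ≤ C * (a ^ 2 / w (k + n + 1)) := by
  rw [← mul_div_assoc, div_le_div_iff₀ (w.pos_succ k) (w.pos_succ (k + n))]
  calc a ^ 2 * w (k + n + 1) ≤ a ^ 2 * (C * w (k + 1)) := by grw [h k]
    _ = C * a ^ 2 * w (k + 1) := by ring

end Weight.RatioLE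

namespace L2

section Shift

variable {w : Weight} {n : ℕ} {C : ℝ}

theorem memL2_shift (h : w.RatioLE n C) (x : L2 w) :
    MemL2 w fun k => if k = 0 then 0 else x (k + n) := by
  refine ⟨by simp, ?_⟩
  refine (((summable_nat_add_iff n).2 x.mem.2).mul_left C).of_nonneg_of_le
    (fun k => div_nonneg (sq_nonneg _) (w.pos_succ k).le) fun k => ?_
  simpa [Nat.add_right_comm k 1 n] using h.sq_div_le (x (k + n + 1)) k

/-- The left shift by `n` places, `x ↦ (0, x(n + 1), x(n + 2), …)`, as a linear map. -/
noncomputable def shiftₗ (h : w.RatioLE n C) : L2 w →ₗ[ℝ] L2 w where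
  toFun x := mk _ (memL2_shift h x)
  map_add' x y := ext_seq fun k => by simp [mk_apply, add_apply]
  map_smul' c x := ext_seq fun k => by simp [mk_apply, smul_apply]

theorem shiftₗ_apply (h : w.RatioLE n C) (x : L2 w) (k : ℕ) :
    shiftₗ h x (k + 1) = x (k + n + 1) := by
  simp [shiftₗ, mk_apply, Nat.add_right_comm k 1 n]

theorem norm_shiftₗ_le (h : w.RatioLE n C) (x : L2 w) : ‖shiftₗ h x‖ ≤ √C * ‖x‖ := by
  have hC := h.nonneg
  have hsum : Summable fun k => x (k + n + 1) ^ 2 / w (k + n + 1) :=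
    (summable_nat_add_iff n).2 x.mem.2
  refine le_of_sq_le_sq ?_ (by positivity)
  calc ‖shiftₗ h x‖ ^ 2 = ∑' k, shiftₗ h x (k + 1) ^ 2 / w (k + 1) := norm_sq _
    _ ≤ ∑' k, C * (x (k + n + 1) ^ 2 / w (k + n + 1)) :=
        (shiftₗ h x).mem.2.tsum_le_tsum
          (fun k => by rw [shiftₗ_apply]; exact h.sq_div_le _ k) (hsum.mul_left C)
    _ = C * ∑' k, x (k + n + 1) ^ 2 / w (k + n + 1) := tsum_mul_left
    _ ≤ C * ‖x‖ ^ 2 := by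
        rw [norm_sq]
        exact mul_le_mul_of_nonneg_left (tsum_comp_le_tsum_of_inj x.mem.2
          (fun k => div_nonneg (sq_nonneg _) (w.pos_succ k).le) (add_left_injective n)) hC
    _ = (√C * ‖x‖) ^ 2 := by rw [mul_pow, Real.sq_sqrt hC]

/-- The left shift by `n` places as a bounded operator on `L₂(w)`. -/
noncomputable def shift (h : w.RatioLE n C) : L2 w →L[ℝ] L2 w :=
  (shiftₗ h).mkContinuous √C (norm_shiftₗ_le h)

theorem shift_apply (h : w.RatioLE n C) (x : L2 w) (k : ℕ) :
    shift h x (k + 1) = x (k + n + 1) :=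
  shiftₗ_apply h x k

theorem norm_shift_le (h : w.RatioLE n C) : ‖shift h‖ ≤ √C :=
  (shiftₗ h).mkContinuous_norm_le (Real.sqrt_nonneg C) (norm_shiftₗ_le h)

theorem shift_pow_apply (h : w.RatioLE 1 C) (n : ℕ) (x : L2 w) (k : ℕ) :
    (shift h ^ n) x (k + 1) = x (k + n + 1) := by
  induction n generalizing x with
  | zero => rfl
  | succ n ih => rw [pow_succ, mul_apply_eq_comp, ih, shift_apply]; rfl

theorem isUnit_one_sub_shift {D : ℝ} (h : w.RatioLE 1 C) (hn : w.RatioLE n D) (hD : D < 1) :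
    IsUnit (1 - shift h) := by
  have hpow : shift h ^ n = shift hn :=
    ContinuousLinearMap.ext fun x => ext_seq fun k => by rw [shift_pow_apply, shift_apply]
  refine isUnit_one_sub_of_norm_pow_lt_one (n := n) ?_
  rw [hpow]
  exact (norm_shift_le hn).trans_lt ((Real.sqrt_lt' one_pos).2 (by rwa [one_pow]))

end Shift

section Adjoint

variable {w : Weight} {C : ℝ}

theorem memL2_single (w : Weight) (k : ℕ) : MemL2 w (Pi.single (k + 1) 1) := by
  refine ⟨by simp, summable_of_ne_finset_zero (s := {k}) fun j hj => ?_⟩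
  have : j + 1 ≠ k + 1 := by simpa using hj
  simp [Pi.single_eq_of_ne this]

/-- The basis sequence supported at `k + 1`; the shift of the index reflects `x(0) = 0`. -/
noncomputable def single (w : Weight) (k : ℕ) : L2 w :=
  mk (Pi.single (k + 1) 1) (memL2_single w k)

theorem single_apply (w : Weight) (k j : ℕ) : single w k (j + 1) = if j = k then 1 else 0 := by
  simp [single, mk_apply, Pi.single_apply]

theorem single_ne_zero (w : Weight) (k : ℕ) : single w k ≠ 0 := fun h => by
  have hk : single w k (k + 1) = 0 := congrArg (fun x : L2 w => x (k + 1)) h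
  simp [single_apply] at hk

theorem inner_single_left (k : ℕ) (x : L2 w) :
    inner ℝ (single w k) x = x (k + 1) / w (k + 1) := by
  rw [inner_def, tsum_eq_single k fun j hj => by simp [single_apply, hj]]
  simp [single_apply]

theorem shift_single_zero (h : w.RatioLE 1 C) : shift h (single w 0) = 0 :=
  ext_seq fun k => by
    rw [shift_apply, single_apply, if_neg k.succ_ne_zero]
    rfl

theorem shift_single_succ (h : w.RatioLE 1 C) (k : ℕ) :
    shift h (single w (k + 1)) = single w k :=
  ext_seq fun j => by simp [shift_apply, single_apply]

-- At `k = 0` both sides vanish, whatever the value of `w 0`.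
theorem star_shift_apply (h : w.RatioLE 1 C) (x : L2 w) (k : ℕ) :
    star (shift h) x (k + 1) = w (k + 1) / w k * x k := by
  have hinner := inner_single_left k (star (shift h) x)
  rw [ContinuousLinearMap.star_eq_adjoint, ContinuousLinearMap.adjoint_inner_right,
    eq_div_iff (w.pos_succ k).ne'] at hinner
  rw [ContinuousLinearMap.star_eq_adjoint, ← hinner]
  cases k with
  | zero => rw [shift_single_zero, inner_zero_left, x.mem.1, zero_mul, mul_zero]
  | succ k =>
    rw [shift_single_succ, inner_single_left]
    ring

end Adjoint

end L2

section Generator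

variable {w : Weight} {β C : ℝ}

/-- The weighted difference operator `B = √β (1 - T)` on `L₂(w)`, where `T` is the left shift. -/
noncomputable def difference (β : ℝ) (h : w.RatioLE 1 C) : L2 w →L[ℝ] L2 w :=
  √β • (1 - L2.shift h)

/-- The operator `-B B*`; by `generator_apply` it is the birth–death operator with death rate `β`
that satisfies detailed balance with respect to `w`. -/
noncomputable def generator (β : ℝ) (h : w.RatioLE 1 C) : L2 w →L[ℝ] L2 w :=
  -(difference β h * star (difference β h))

theorem isSelfAdjoint_generator (h : w.RatioLE 1 C) : IsSelfAdjoint (generator β h) :=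
  (IsSelfAdjoint.mul_star_self _).neg

theorem difference_single_zero (h : w.RatioLE 1 C) :
    difference β h (L2.single w 0) = √β • L2.single w 0 := by
  rw [difference, smul_apply, sub_apply, one_apply_eq_self, L2.shift_single_zero, sub_zero]

theorem isUnit_difference {n : ℕ} {D : ℝ} (hβ : 0 < β) (h : w.RatioLE 1 C) (hn : w.RatioLE n D)
    (hD : D < 1) : IsUnit (difference β h) :=
  (L2.isUnit_one_sub_shift h hn hD).smul (Units.mk0 √β (Real.sqrt_pos.2 hβ).ne')

theorem exists_isLeast_spectrum_neg_generator {n : ℕ} {D : ℝ} (hβ : 0 < β) (h : w.RatioLE 1 C)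
    (hn : w.RatioLE n D) (hD : D < 1) :
    ∃ γ, IsLeast (spectrum ℝ (-generator β h)) γ ∧ 0 < γ ∧ γ ≤ β := by
  rw [generator, neg_neg, ← Real.sq_sqrt hβ.le]
  simpa only [Real.sq_sqrt hβ.le] using exists_isLeast_spectrum_mul_star
    (isUnit_difference hβ h hn hD) (L2.single_ne_zero w 0) (difference_single_zero h)

theorem generator_eq (hβ : 0 ≤ β) (h : w.RatioLE 1 C) :
    generator β h = β • ((L2.shift h - 1) * (1 - star (L2.shift h))) := by
  rw [generator, difference, star_smul, star_sub, star_one, star_trivial, smul_mul_smul_comm,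
    Real.mul_self_sqrt hβ, ← smul_neg, ← neg_mul, neg_sub]

theorem generator_apply (hβ : 0 ≤ β) (h : w.RatioLE 1 C) (x : L2 w) (k : ℕ) :
    generator β h x (k + 1) = β * (w (k + 1) / w k) * x k
      - (β * (w (k + 2) / w (k + 1)) + β) * x (k + 1) + β * x (k + 2) := by
  have hdiff : ∀ j, (1 - star (L2.shift h)) x (j + 1) = x (j + 1) - w (j + 1) / w j * x j :=
    fun j => congrArg (x (j + 1) - ·) (L2.star_shift_apply h x j)
  have hgen : generator β h x (k + 1) = β * ((1 - star (L2.shift h)) x (k + 1 + 1)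
      - (1 - star (L2.shift h)) x (k + 1)) := by
    rw [generator_eq hβ]
    exact congrArg (fun a => β * (a - _)) (L2.shift_apply h _ k)
  rw [hgen, hdiff, hdiff]
  ring

end Generator

section Potential

theorem mul_uTilde_pow (ρ : ℝ) {L : ℕ} (hL : 1 ≤ L) (k : ℕ) :
    ρ * uTilde ρ L k ^ (L - 1) = ρ ^ L ^ k := by
  rw [uTilde, ← pow_mul, ← pow_succ', geom_sum_mul_of_one_le hL,
    Nat.sub_add_cancel (Nat.one_le_pow _ _ hL)]

variable {ρ : ℝ} {L : ℕ} (hρ : 0 < ρ) (hL : 1 ≤ L)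

theorem potential_apply (k : ℕ) :
    potential ρ L hρ hL k = (L : ℝ) ^ (k - 1) * ρ ^ ∑ i ∈ Finset.Ico 1 k, L ^ i := rfl

theorem potential_one : potential ρ L hρ hL 1 = 1 := by simp [potential_apply]

theorem potential_add_two (k : ℕ) :
    potential ρ L hρ hL (k + 2) = L * ρ ^ L ^ (k + 1) * potential ρ L hρ hL (k + 1) := by
  rw [potential_apply, potential_apply, Finset.sum_Ico_succ_top (by lia), pow_add,
    show k + 2 - 1 = k + 1 by lia, Nat.add_sub_cancel, pow_succ (L : ℝ) k]
  ring

theorem ratioLE_potential (hρ1 : ρ ≤ 1) (n : ℕ) :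
    (potential ρ L hρ hL).RatioLE n (potential ρ L hρ hL (n + 1)) := by
  intro k
  induction n with
  | zero => simp [potential_one]
  | succ n ih =>
    have hpow : ρ ^ L ^ (k + n + 1) ≤ ρ ^ L ^ (n + 1) :=
      pow_le_pow_of_le_one hρ.le hρ1 (Nat.pow_le_pow_right hL (by lia))
    calc potential ρ L hρ hL (k + n + 2)
        = L * ρ ^ L ^ (k + n + 1) * potential ρ L hρ hL (k + n + 1) := potential_add_two ..
      _ ≤ L * ρ ^ L ^ (n + 1) * (potential ρ L hρ hL (n + 1) * potential ρ L hρ hL (k + 1)) := by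
          have := (potential ρ L hρ hL).pos_succ (k + n)
          gcongr
      _ = potential ρ L hρ hL (n + 2) * potential ρ L hρ hL (k + 1) := by
          rw [potential_add_two]
          ring

theorem tendsto_potential (hρ1 : ρ < 1) :
    Filter.Tendsto (potential ρ L hρ hL) Filter.atTop (nhds 0) := by
  refine (Filter.tendsto_add_atTop_iff_nat 1).1 ?_
  obtain rfl | hL2 := hL.eq_or_lt
  · simpa [potential_apply] using tendsto_pow_atTop_nhds_zero_of_lt_one hρ.le hρ1
  · have hlim : Filter.Tendsto (fun n => ((L ^ n : ℕ) : ℝ) * ρ ^ L ^ n) Filter.atTop (nhds 0) :=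
      (tendsto_self_mul_const_pow_of_lt_one hρ.le hρ1).comp
        (tendsto_pow_atTop_atTop_of_one_lt hL2)
    refine squeeze_zero' (.of_forall fun n => ((potential ρ L hρ hL).pos_succ n).le)
      (Filter.eventually_atTop.2 ⟨1, fun n hn => ?_⟩) hlim
    have hexp : L ^ n ≤ ∑ i ∈ Finset.Ico 1 (n + 1), L ^ i :=
      Finset.single_le_sum (f := (L ^ ·)) (fun _ _ => Nat.zero_le _)
        (Finset.mem_Ico.2 ⟨hn, n.lt_succ_self⟩)
    rw [potential_apply, Nat.add_sub_cancel, Nat.cast_pow]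
    exact mul_le_mul_of_nonneg_left (pow_le_pow_of_le_one hρ.le hρ1.le hexp) (by positivity)

end Potential

theorem generator_seq {α β : ℝ} {L : ℕ} (hα : 0 < α) (hβ : 0 < β) (hL : 1 ≤ L) {C : ℝ}
    (h : (potential (α / β) L (div_pos hα hβ) hL).RatioLE 1 C)
    (x : L2 (potential (α / β) L (div_pos hα hβ) hL)) :
    (generator β h x).seq = opK α β L (uTilde (α / β) L) x.seq := by
  have hbalance (k : ℕ) : β * (potential (α / β) L (div_pos hα hβ) hL (k + 2)
      / potential (α / β) L (div_pos hα hβ) hL (k + 1))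
      = α * L * uTilde (α / β) L (k + 1) ^ (L - 1) := by
    rw [potential_add_two, mul_div_cancel_right₀ _ (Weight.pos_succ _ k).ne', ← mul_uTilde_pow _ hL]
    field_simp
  funext k
  rcases k with _ | _ | k
  · exact (generator β h x).mem.1
  · rw [generator_apply hβ.le, hbalance, opK, x.mem.1, mul_zero, mul_zero]
  · rw [generator_apply hβ.le, hbalance, hbalance, opK]

end MeanFieldQueue

open MeanFieldQueue in
theorem theorem2p7 (α β : ℝ) (L : ℕ) (hα : 0 < α) (hβ : 0 < β) (hαβ : α / β < 1) (hL : 1 ≤ L) :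
    ∃ 𝒦 : L2 (potential (α / β) L (div_pos hα hβ) hL) →L[ℝ]
        L2 (potential (α / β) L (div_pos hα hβ) hL),
      (∀ x, (𝒦 x).seq = opK α β L (uTilde (α / β) L) x.seq) ∧
      IsSelfAdjoint 𝒦 ∧
      ∃ γ : ℝ, IsLeast (spectrum ℝ (-𝒦)) γ ∧ 0 < γ ∧ γ ≤ β ∧
        ∀ z₀ : L2 (potential (α / β) L (div_pos hα hβ) hL),
          (∀ t : ℝ, 0 ≤ t → HasDerivWithinAt (fun s : ℝ => NormedSpace.exp (s • 𝒦) z₀)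
            (𝒦 (NormedSpace.exp (t • 𝒦) z₀)) (Set.Ici 0) t) ∧
          (∀ z : ℝ → L2 (potential (α / β) L (div_pos hα hβ) hL), z 0 = z₀ →
            (∀ t : ℝ, 0 ≤ t → HasDerivWithinAt z (𝒦 (z t)) (Set.Ici 0) t) →
            ∀ t : ℝ, 0 ≤ t → z t = NormedSpace.exp (t • 𝒦) z₀) ∧
          ∀ t : ℝ, 0 ≤ t → ‖NormedSpace.exp (t • 𝒦) z₀‖ ≤ Real.exp (-γ * t) * ‖z₀‖ := by
  have hρ := div_pos hα hβ
  have hshift := ratioLE_potential hρ hL hαβ.le 1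
  obtain ⟨n, hn⟩ := (((Filter.tendsto_add_atTop_iff_nat 1).2
    (tendsto_potential hρ hL hαβ)).eventually_lt_const one_pos).exists
  obtain ⟨γ, hγ, hγ_pos, hγ_le⟩ :=
    exists_isLeast_spectrum_neg_generator hβ hshift (ratioLE_potential hρ hL hαβ.le n) hn
  have hself := isSelfAdjoint_generator (β := β) hshift
  refine ⟨generator β hshift, generator_seq hα hβ hL hshift, hself, γ, hγ, hγ_pos, hγ_le,
    fun z₀ => ⟨fun t _ => (hasDerivAt_exp_smul_apply _ z₀ t).hasDerivWithinAt, ?_,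
      fun t ht => ?_⟩⟩
  · rintro z rfl hz t ht
    exact eq_exp_smul_apply_of_hasDerivWithinAt _ hz ht
  · simpa only [neg_neg] using norm_exp_smul_neg_apply_le hself.neg hγ z₀ ht
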